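/- Let $N\ge 0$ and let $\mathcal L:M_N(\mathbb C)\to M_N(\mathbb C)$ be the generator of a quantum dynamical semigroup $(T_t)_{t\ge0}$ on $M_N(\mathbb C)$ (linear maps with $T_0=\mathrm{id}$, $T_{t+s}=T_tT_s$, $t\mapsto T_t(A)$ continuous for every $A$, each $T_t$ trace preserving and completely positive), i.e. $\mathcal L(x)=\lim_{t\downarrow0}\frac1t(T_t(x)-x)$ for all $x$. Let $E_{ij}$ be the standard basis matrices. By a standard form of $\mathcal L$ we mean an expression $$\mathcal L(\rho)=-i[H,\rho]+\frac12\sum_{i,j,k,\ell=1}^N\gamma_{ijk\ell}\left([E_{ij},\rho E_{k\ell}^*]+[E_{ij}\rho,E_{k\ell}^*]\right)\qquad(\rho\in M_N(\mathbb C))$$ with $H$ Hermitian and $\Gamma=(\gamma_{ijk\ell})$ an $N^2\times N^2$ complex matrix which, regarded as an operator on $M_N(\mathbb C)$ via $\Gamma(E_{k\ell})=\sum_{i,j}\gamma_{ijk\ell}E_{ij}$, satisfies: (1) the compression $P\Gamma|_{M_N^0(\mathbb C)}$ to the space $M_N^0(\mathbb C)$ of traceless matrices is positive semidefinite with respect to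 $\langle A,B\rangle=\operatorname{Tr}(A^*B)$, where $P$ is the orthogonal projection onto $M_N^0(\mathbb C)$; and (2) $\operatorname{Re}\operatorname{Tr}(\Gamma(A))=\operatorname{Re}\operatorname{Tr}(\Gamma(I_N)A)$ for all Hermitian $A$. Let $\Gamma^{\mathcal O}$ be the principal submatrix of $\Gamma$ with rows and columns indexed by the $E_{ij}$, $i\neq j$, and write $\gamma_{ij}=\gamma_{ijij}$ ($i\ne j$) for its diagonal entries. Then $\mathcal L$ has a standard form, and there is a unique weighted digraph $G_{\mathcal L}$ without loops on the vertices $1,\dots,N$ such that for every standard form of $\mathcal L$ and all $i\ne j$ the weight of the edge from $j$ to $i$ is $\gamma_{ij}$ (in particular $\gamma_{ij}$ is real, nonnegative and independent of the standard form; there is no edge if $\gamma_{ij}=0$). Moreover, let $\mathcal L^{\mathcal D}$ be the compression of $\mathcal L$ to the diagonal subalgebra, i.e. the $N\times N$ submatrix of the matrix of $\mathcal L$ in the standard basis with rows and columns indexed by $E_{11},\dots,E_{NN}$. Then $$\mathcal L^{\mathcal D}=L(G_{\mathcal L}),$$ where the digraph Laplacian $L(G)$ of a digraph $G$, with $w_{ij}$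 the weight of the edge from $j$ to $i$ (and $w_{ij}=0$ if there is no such edge), has entries $L(G)_{ij}=w_{ij}$ for $i\neq j$ and $L(G)_{jj}=-\sum_{k\neq j}w_{kj}$. -/

import Mathlib

open scoped ComplexOrder NNReal Topology
open Filter

noncomputable section

namespace QDS

/-! ### Quantum dynamical semigroups and their generators -/

/-- The algebra of `N × N` complex matrices. -/
abbrev Mat (N : ℕ) : Type := Matrix (Fin N) (Fin N) ℂ

/-- A linear map `Φ` on `N × N` matrices is completely positive if for every `k` its entrywise
application to `k × k` block matrices with blocks of size `N × N` (the map `id ⊗ Φ`) preserves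
positive semidefiniteness. `Matrix.comp` flattens a block matrix to an ordinary matrix. -/
def IsCompletelyPositive {N : ℕ} (Φ : Mat N →ₗ[ℂ] Mat N) : Prop :=
  ∀ (k : ℕ) (M : Matrix (Fin k) (Fin k) (Mat N)),
    (Matrix.comp (Fin k) (Fin k) (Fin N) (Fin N) ℂ M).PosSemidef →
      (Matrix.comp (Fin k) (Fin k) (Fin N) (Fin N) ℂ (M.map Φ)).PosSemidef

/-- A quantum dynamical semigroup (Schrödinger picture) on the `N × N` complex matrices. -/
structure IsQDS {N : ℕ} (T : ℝ≥0 → (Mat N →ₗ[ℂ] Mat N)) : Prop where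
  zero : T 0 = LinearMap.id
  add : ∀ t s : ℝ≥0, T (t + s) = T t ∘ₗ T s
  continuous : ∀ A : Mat N, Continuous fun t : ℝ≥0 => T t A
  trace : ∀ (t : ℝ≥0) (A : Mat N), (T t A).trace = A.trace
  completelyPositive : ∀ t : ℝ≥0, IsCompletelyPositive (T t)

/-- `L` is the generator of some quantum dynamical semigroup `T`:
`L x = lim_{t ↓ 0} (T_t x - x) / t` for every `x`. -/
def IsQDSGenerator {N : ℕ} (L : Mat N →ₗ[ℂ] Mat N) : Prop :=
  ∃ T : ℝ≥0 → (Mat N →ₗ[ℂ] Mat N), IsQDS T ∧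
    ∀ x : Mat N, Tendsto (fun t : ℝ≥0 => (t : ℝ)⁻¹ • (T t x - x)) (𝓝[>] 0) (𝓝 (L x))

/-! ### The form of a generator with respect to the standard basis -/

/-- The standard basis matrix `E_{ij}`. -/
def E {N : ℕ} (i j : Fin N) : Mat N := Matrix.single i j 1

/-- The coefficient matrix `Γ = (γ_{ijkl})` of size `N² × N²`, with `γ_{ijkl} = Γ (i, j) (k, l)`. -/
abbrev CoeffMat (N : ℕ) : Type := Matrix (Fin N × Fin N) (Fin N × Fin N) ℂ

/-- `-i[H, ρ] + ½ ∑ γ_{ijkl} ([E_{ij}, ρ E_{kl}^*] + [E_{ij} ρ, E_{kl}^*])`. -/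
def gkslForm {N : ℕ} (H : Mat N) (Γ : CoeffMat N) (ρ : Mat N) : Mat N :=
  -Complex.I • ⁅H, ρ⁆ +
    (1 / 2 : ℂ) • ∑ i, ∑ j, ∑ k, ∑ l, Γ (i, j) (k, l) •
      (⁅E i j, ρ * (E k l).conjTranspose⁆ + ⁅E i j * ρ, (E k l).conjTranspose⁆)

/-- The coefficient matrix regarded as an operator on matrices through the standard basis:
`Γ(E_{kl}) = ∑_{ij} γ_{ijkl} E_{ij}`. -/
def coeffOp {N : ℕ} (Γ : CoeffMat N) (A : Mat N) : Mat N :=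
  Matrix.of fun i j => ∑ k, ∑ l, Γ (i, j) (k, l) * A k l

/-- The orthogonal projection (for the Hilbert-Schmidt inner product) onto the traceless
matrices. -/
def tracelessProj {N : ℕ} (A : Mat N) : Mat N := A - (A.trace / (N : ℂ)) • (1 : Mat N)

/-- The conditions on `Γ`: the compression of `Γ` to the traceless matrices is positive
semidefinite for the Hilbert-Schmidt inner product `⟨A, B⟩ = Tr(A^* B)` (the complex inequality
says that the value is real and nonnegative), and
`Re Tr Γ(A) = Re Tr(Γ(I) A)` for Hermitian `A`. -/
structure IsAdmissible {N : ℕ} (Γ : CoeffMat N) : Prop where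
  nonneg : ∀ A : Mat N, A.trace = 0 →
    0 ≤ (A.conjTranspose * tracelessProj (coeffOp Γ A)).trace
  trace : ∀ A : Mat N, A.IsHermitian →
    (coeffOp Γ A).trace.re = (coeffOp Γ 1 * A).trace.re

/-- `L` is written with respect to the standard basis with Hamiltonian `H` and coefficient
matrix `Γ`. -/
structure IsStandardForm {N : ℕ} (L : Mat N →ₗ[ℂ] Mat N) (H : Mat N) (Γ : CoeffMat N) :
    Prop where
  hermitian : H.IsHermitian
  admissible : IsAdmissible Γ
  form : ∀ ρ : Mat N, L ρ = gkslForm H Γ ρ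

/-- The principal submatrix `Γ^O` of `Γ` with rows and columns indexed by the off-diagonal
standard basis matrices `E_{ij}`, `i ≠ j`. -/
def gammaO {N : ℕ} (Γ : CoeffMat N) :
    Matrix {p : Fin N × Fin N // p.1 ≠ p.2} {p : Fin N × Fin N // p.1 ≠ p.2} ℂ :=
  Γ.submatrix Subtype.val Subtype.val

/-- The compression `L^D` of `L` to the diagonal subalgebra: the submatrix of the matrix of `L`
in the standard basis with rows and columns indexed by `E_{11}, …, E_{NN}`. -/
def compressionD {N : ℕ} (L : Mat N →ₗ[ℂ] Mat N) : Matrix (Fin N) (Fin N) ℂ :=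
  (LinearMap.toMatrix (Matrix.stdBasis ℂ (Fin N) (Fin N)) (Matrix.stdBasis ℂ (Fin N) (Fin N))
    L).submatrix (fun i => (i, i)) (fun j => (j, j))

/-! ### Weighted digraphs -/

/-- A digraph with positive edge weights: the edge from `i` to `j` has weight `w j i > 0`
(note the reversal of the indices), and `w j i = 0` if there is no edge from `i` to `j`. -/
structure WeightedDigraph (V : Type*) extends Digraph V where
  w : V → V → ℝ
  w_pos : ∀ i j, Adj i j → 0 < w j i
  w_eq_zero : ∀ i j, ¬ Adj i j → w j i = 0

/-- The digraph Laplacian. -/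
def WeightedDigraph.laplacian {V : Type*} [Fintype V] [DecidableEq V] (G : WeightedDigraph V) :
    Matrix V V ℝ :=
  Matrix.of fun i j => if i = j then -∑ k ∈ Finset.univ.erase j, G.w k j else G.w i j

/-- `G` is the loopless digraph in which, for `i ≠ j`, the weight of the edge from `j` to `i` is
the diagonal entry `γ_{ij} = γ_{ijij}` of `Γ^O` (no edge if that entry is zero). -/
structure IsDigraphOfCoeff {N : ℕ} (G : WeightedDigraph (Fin N)) (Γ : CoeffMat N) : Prop where
  loopless : ∀ i, ¬ G.Adj i i
  weight : ∀ (i j : Fin N) (hij : i ≠ j),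
    (G.w i j : ℂ) = gammaO Γ ⟨(i, j), hij⟩ ⟨(i, j), hij⟩

/-- `G` is the digraph `G_L` of `L`: there is a representation of `L` with respect to the standard
basis, and every such representation yields `G`. -/
def IsGeneratorDigraph {N : ℕ} (L : Mat N →ₗ[ℂ] Mat N) (G : WeightedDigraph (Fin N)) : Prop :=
  (∃ H Γ, IsStandardForm L H Γ) ∧ ∀ H Γ, IsStandardForm L H Γ → IsDigraphOfCoeff G Γ

end QDS

end

namespace QDS

open Matrix

variable {N : ℕ}

/-! Two observations carry the theorem. Existence: a generator is its own completely positive part.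
With `H = 0` and `Γ` the Choi matrix of `L`, the anticommutator term vanishes because `L` kills
traces (`IsQDSGenerator.isStandardForm_choi`). Admissibility follows by writing this `Γ` as the
limit of difference quotients: the Choi matrix of `T t` is positive semidefinite, and that of the
identity vanishes as a form on traceless matrices. Uniqueness: in any standard form the `(i, i)`
entry of `L (E j j)`, `i ≠ j`, is `γ_{ijij}` (`gkslForm_E_apply`), so the weights depend on `L`
alone. These are also the off-diagonal entries of the compression; the diagonal ones follow from the
vanishing trace. -/

/-- The completely positive part `∑ γ_{ijkl} E_{ij} ρ E_{kl}^*`, written entrywise. -/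
def sandwich (Γ : CoeffMat N) (ρ : Mat N) : Mat N :=
  Matrix.of fun i k => ∑ j, ∑ l, Γ (i, j) (k, l) * ρ j l

/-- The matrix `∑ γ_{ijkl} E_{kl}^* E_{ij}`, written entrywise. -/
def anticommPart (Γ : CoeffMat N) : Mat N :=
  Matrix.of fun l j => ∑ i, Γ (i, j) (i, l)

theorem sum_smul_E_mul_mul (Γ : CoeffMat N) (ρ : Mat N) :
    ∑ i, ∑ j, ∑ k, ∑ l, Γ (i, j) (k, l) • (E i j * ρ * (E k l)ᴴ) = sandwich Γ ρ := by
  ext a b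
  have h : ∀ i j k l : Fin N, (E i j * ρ * (E k l)ᴴ) a b =
      if i = a then if k = b then ρ j l else 0 else 0 := by
    intro i j k l
    simp only [E, conjTranspose_single, star_one]
    by_cases hk : k = b
    · subst hk
      by_cases hi : i = a
      · subst hi; simp
      · simp [hi, Ne.symm hi]
    · simp [hk, Ne.symm hk]
  simp only [Matrix.sum_apply, Matrix.smul_apply, h, sandwich, Matrix.of_apply, smul_eq_mul,
    mul_ite, mul_zero, Finset.sum_ite_irrel, Finset.sum_const_zero, Finset.sum_ite_eq',
    Finset.mem_univ, if_true]

theorem sum_smul_E_mul_E (Γ : CoeffMat N) :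
    ∑ i, ∑ j, ∑ k, ∑ l, Γ (i, j) (k, l) • ((E k l)ᴴ * E i j) = anticommPart Γ := by
  ext a b
  have h : ∀ i j k l : Fin N, ((E k l)ᴴ * E i j) a b =
      if i = k then if l = a then if j = b then 1 else 0 else 0 else 0 := by
    intro i j k l
    simp only [E, conjTranspose_single, star_one]
    by_cases hk : i = k
    · subst hk
      simp [Matrix.single_apply, ite_and]
    · simp [hk, Matrix.single_mul_single_of_ne _ _ _ _ (Ne.symm hk)]
  simp only [Matrix.sum_apply, Matrix.smul_apply, h, anticommPart, Matrix.of_apply, smul_eq_mul,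
    mul_ite, mul_zero, mul_one, Finset.sum_ite_irrel, Finset.sum_const_zero, Finset.sum_ite_eq,
    Finset.sum_ite_eq', Finset.mem_univ, if_true]

theorem gkslForm_eq (H : Mat N) (Γ : CoeffMat N) (ρ : Mat N) :
    gkslForm H Γ ρ = -Complex.I • ⁅H, ρ⁆ +
      (sandwich Γ ρ - (1 / 2 : ℂ) • (ρ * anticommPart Γ + anticommPart Γ * ρ)) := by
  have key : ∑ i, ∑ j, ∑ k, ∑ l, Γ (i, j) (k, l) •
      (⁅E i j, ρ * (E k l)ᴴ⁆ + ⁅E i j * ρ, (E k l)ᴴ⁆) =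
      (2 : ℂ) • sandwich Γ ρ - (ρ * anticommPart Γ + anticommPart Γ * ρ) := by
    rw [← sum_smul_E_mul_mul, ← sum_smul_E_mul_E]
    simp only [Finset.smul_sum, Finset.mul_sum, Finset.sum_mul, ← Finset.sum_add_distrib,
      ← Finset.sum_sub_distrib]
    refine Finset.sum_congr rfl fun i _ => Finset.sum_congr rfl fun j _ =>
      Finset.sum_congr rfl fun k _ => Finset.sum_congr rfl fun l _ => ?_
    simp only [Ring.lie_def, Matrix.mul_smul, Matrix.smul_mul, Matrix.mul_assoc]
    module
  rw [gkslForm, key]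
  module

theorem trace_gkslForm (H : Mat N) (Γ : CoeffMat N) (ρ : Mat N) :
    (gkslForm H Γ ρ).trace = 0 := by
  simp only [gkslForm, Matrix.trace_add, Matrix.trace_smul, Matrix.trace_sum, Ring.lie_def,
    Matrix.trace_sub, Matrix.trace_mul_comm H ρ]
  rw [sub_self, smul_zero, zero_add]
  refine smul_eq_zero_of_right _ (Finset.sum_eq_zero fun i _ => Finset.sum_eq_zero fun j _ =>
    Finset.sum_eq_zero fun k _ => Finset.sum_eq_zero fun l _ => ?_)
  rw [Matrix.trace_mul_comm (E i j) (ρ * _), Matrix.trace_mul_comm (E i j * ρ)]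
  simp

/-- Row and column `i` of `E j j` vanish, so neither the commutator nor the anticommutator reaches
the `(i, i)` entry. -/
theorem gkslForm_E_apply (H : Mat N) (Γ : CoeffMat N) {i j : Fin N} (hij : i ≠ j) :
    gkslForm H Γ (E j j) i i = Γ (i, j) (i, j) := by
  rw [gkslForm_eq]
  simp [E, Ring.lie_def, sandwich, hij, Matrix.single_apply, ite_and]

/-! ### The Choi matrix as a standard form -/

/-- The coefficients of a linear map: `Φ(ρ) = ∑ γ_{ijkl} E_{ij} ρ E_{kl}^*` (the Choi matrix). -/
def choi (Φ : Mat N →ₗ[ℂ] Mat N) : CoeffMat N :=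
  Matrix.of fun p q => Φ (E p.2 q.2) p.1 q.1

theorem sandwich_choi (Φ : Mat N →ₗ[ℂ] Mat N) (ρ : Mat N) : sandwich (choi Φ) ρ = Φ ρ := by
  have hρ : ρ = ∑ j, ∑ l, ρ j l • E j l := by
    conv_lhs => rw [Matrix.matrix_eq_sum_single ρ]
    simp [E]
  ext i k
  conv_rhs => rw [hρ]
  simp [sandwich, choi, Matrix.sum_apply, mul_comm]

theorem anticommPart_choi_eq_zero {Φ : Mat N →ₗ[ℂ] Mat N} (h : ∀ A, (Φ A).trace = 0) :
    anticommPart (choi Φ) = 0 := by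
  ext l j
  exact h (E j l)

/-- Choi's argument: apply complete positivity to the rank-one positive block matrix with blocks `E
a b`. -/
theorem IsCompletelyPositive.posSemidef_choi {Φ : Mat N →ₗ[ℂ] Mat N}
    (h : IsCompletelyPositive Φ) : (choi Φ).PosSemidef := by
  have h1 : (Matrix.comp (Fin N) (Fin N) (Fin N) (Fin N) ℂ
      (Matrix.of fun a b => (E a b : Mat N))).PosSemidef := by
    convert Matrix.posSemidef_vecMulVec_self_star
      (fun p : Fin N × Fin N => if p.1 = p.2 then (1 : ℂ) else 0) using 1
    ext ⟨a, i⟩ ⟨b, j⟩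
    by_cases hi : a = i <;> by_cases hj : b = j <;>
      simp [E, Matrix.vecMulVec_apply, Matrix.comp_apply, hi, hj]
  -- `Matrix.comp` puts the block index first, `choi` puts it second.
  exact (h N _ h1).submatrix Prod.swap

theorem trace_conjTranspose_mul_coeffOp (Γ : CoeffMat N) (A B : Mat N) :
    (Aᴴ * coeffOp Γ B).trace =
      star (fun p : Fin N × Fin N => A p.1 p.2) ⬝ᵥ (Γ *ᵥ fun p => B p.1 p.2) := by
  simp only [Matrix.trace, Matrix.diag, Matrix.mul_apply, dotProduct, Matrix.mulVec, coeffOp,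
    Matrix.of_apply, Matrix.conjTranspose_apply, Fintype.sum_prod_type, Pi.star_apply]
  exact Finset.sum_comm

/-- Traceless matrices are orthogonal to the scalars, so the projection can be dropped. -/
theorem trace_conjTranspose_mul_tracelessProj {A : Mat N} (hA : A.trace = 0) (B : Mat N) :
    (Aᴴ * tracelessProj B).trace = (Aᴴ * B).trace := by
  simp [tracelessProj, Matrix.mul_sub, Matrix.trace_conjTranspose, hA]

/-- The Choi matrix of the identity acts as `A ↦ Tr(A) I`. -/
theorem trace_conjTranspose_mul_coeffOp_choi_id {A : Mat N} (hA : A.trace = 0) :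
    (Aᴴ * coeffOp (choi LinearMap.id) A).trace = 0 := by
  have : coeffOp (choi LinearMap.id) A = A.trace • (1 : Mat N) := by
    ext i j
    by_cases hij : i = j
    · subst hij
      simp [coeffOp, choi, E, Matrix.single_apply, ite_and, Matrix.trace]
    · simp [coeffOp, choi, E, Matrix.single_apply, ite_and, hij, Ne.symm hij]
  simp [this, hA]

/-- When `Γ` is self-adjoint and `A` Hermitian, `Tr(Γ(I) A)` is the complex conjugate of `Tr Γ(A)`,
which gives the trace condition. -/
theorem isAdmissible_of_isHermitian {Γ : CoeffMat N} (hΓ : Γ.IsHermitian)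
    (h : ∀ A : Mat N, A.trace = 0 → 0 ≤ (Aᴴ * coeffOp Γ A).trace) : IsAdmissible Γ where
  nonneg A hA := by
    rw [trace_conjTranspose_mul_tracelessProj hA]
    exact h A hA
  trace A hA := by
    have h1 := trace_conjTranspose_mul_coeffOp Γ 1 A
    have h2 := trace_conjTranspose_mul_coeffOp Γ A 1
    rw [conjTranspose_one, one_mul] at h1
    rw [hA.eq, Matrix.trace_mul_comm] at h2
    have h3 : (coeffOp Γ 1 * A).trace = star (coeffOp Γ A).trace := by
      rw [h1, h2, ← Matrix.star_dotProduct, Matrix.star_mulVec, hΓ.eq, Matrix.dotProduct_mulVec]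
    rw [h3]
    simp

theorem IsQDSGenerator.trace_eq_zero {L : Mat N →ₗ[ℂ] Mat N} (hL : IsQDSGenerator L)
    (A : Mat N) : (L A).trace = 0 := by
  obtain ⟨T, hT, h⟩ := hL
  have h1 := ((continuous_id.matrix_trace).tendsto (L A)).comp (h A)
  refine tendsto_nhds_unique h1 (tendsto_const_nhds.congr fun t => ?_)
  simp [Matrix.trace_smul, Matrix.trace_sub, hT.trace]

theorem tendsto_choi {T : ℝ≥0 → (Mat N →ₗ[ℂ] Mat N)} {L : Mat N →ₗ[ℂ] Mat N}
    (h : ∀ x : Mat N, Tendsto (fun t : ℝ≥0 => (t : ℝ)⁻¹ • (T t x - x)) (𝓝[>] 0) (𝓝 (L x))) :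
    Tendsto (fun t : ℝ≥0 => (t : ℝ)⁻¹ • (choi (T t) - choi LinearMap.id)) (𝓝[>] 0)
      (𝓝 (choi L)) := by
  refine tendsto_pi_nhds.2 fun p => tendsto_pi_nhds.2 fun q => ?_
  exact tendsto_pi_nhds.1 (tendsto_pi_nhds.1 (h (E p.2 q.2)) p.1) q.1

theorem isHermitian_choi_id : (choi (LinearMap.id : Mat N →ₗ[ℂ] Mat N)).IsHermitian := by
  ext p q
  by_cases hp : p.2 = p.1 <;> by_cases hq : q.2 = q.1 <;>
    simp [choi, E, Matrix.single_apply, hp, hq]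

theorem IsQDSGenerator.isAdmissible_choi {L : Mat N →ₗ[ℂ] Mat N} (hL : IsQDSGenerator L) :
    IsAdmissible (choi L) := by
  obtain ⟨T, hT, h⟩ := hL
  have hlim := tendsto_choi h
  have hpos := fun t => (hT.completelyPositive t).posSemidef_choi
  refine isAdmissible_of_isHermitian ?_ fun A hA => ?_
  · have h1 := ((continuous_id.matrix_conjTranspose).tendsto (choi L)).comp hlim
    refine tendsto_nhds_unique h1 (hlim.congr fun t => ?_)
    simp only [Function.comp, id]
    rw [conjTranspose_smul, conjTranspose_sub, (hpos t).isHermitian.eq, isHermitian_choi_id.eq]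
    simp
  · have hcont : Continuous fun Γ : CoeffMat N => (Aᴴ * coeffOp Γ A).trace := by
      simp only [trace_conjTranspose_mul_coeffOp]
      fun_prop
    refine ge_of_tendsto' ((hcont.tendsto (choi L)).comp hlim) fun t => ?_
    -- On traceless `A` the subtracted identity contributes nothing, leaving `t⁻¹` times a
    -- nonnegative form.
    have hid := trace_conjTranspose_mul_coeffOp_choi_id hA
    simp only [Function.comp]
    rw [trace_conjTranspose_mul_coeffOp] at hid ⊢
    rw [Matrix.smul_mulVec, Matrix.sub_mulVec, dotProduct_smul, dotProduct_sub, hid, sub_zero]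
    exact smul_nonneg (by positivity) ((hpos t).dotProduct_mulVec_nonneg _)

theorem IsQDSGenerator.isStandardForm_choi {L : Mat N →ₗ[ℂ] Mat N} (hL : IsQDSGenerator L) :
    IsStandardForm L 0 (choi L) where
  hermitian := Matrix.isHermitian_zero
  admissible := hL.isAdmissible_choi
  form ρ := by
    simp [gkslForm_eq, Ring.lie_def, sandwich_choi, anticommPart_choi_eq_zero hL.trace_eq_zero]

/-! ### The digraph and its Laplacian -/

/-- For `i ≠ j` the matrix `E i j` is traceless, so positivity can be tested on it. -/
theorem IsAdmissible.diag_nonneg {Γ : CoeffMat N} (hΓ : IsAdmissible Γ) {i j : Fin N}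
    (hij : i ≠ j) : 0 ≤ Γ (i, j) (i, j) := by
  have htr : (E i j : Mat N).trace = 0 := Matrix.trace_single_eq_of_ne i j 1 hij
  have h := hΓ.nonneg (E i j) htr
  rw [trace_conjTranspose_mul_tracelessProj htr] at h
  rw [trace_conjTranspose_mul_coeffOp] at h
  simpa [E, dotProduct, Matrix.mulVec, Fintype.sum_prod_type, Matrix.single_apply, ite_and,
    apply_ite star] using h

theorem IsStandardForm.apply_E {L : Mat N →ₗ[ℂ] Mat N} {H : Mat N} {Γ : CoeffMat N}
    (h : IsStandardForm L H Γ) {i j : Fin N} (hij : i ≠ j) :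
    L (E j j) i i = Γ (i, j) (i, j) := by
  rw [h.form, gkslForm_E_apply H Γ hij]

theorem compressionD_apply (L : Mat N →ₗ[ℂ] Mat N) (i j : Fin N) :
    compressionD L i j = L (E j j) i i := by
  simp only [compressionD, Matrix.submatrix_apply, LinearMap.toMatrix_apply,
    Matrix.stdBasis_eq_single, E]
  rfl

/-- The loopless digraph whose edge from `j` to `i` has the weight `L(E_{jj})_{ii}`. -/
noncomputable def generatorDigraph (L : Mat N →ₗ[ℂ] Mat N) : WeightedDigraph (Fin N) where
  Adj j i := i ≠ j ∧ 0 < (L (E j j) i i).re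
  w i j := if i ≠ j ∧ 0 < (L (E j j) i i).re then (L (E j j) i i).re else 0
  w_pos i j h := by rw [if_pos h]; exact h.2
  w_eq_zero i j h := if_neg h

theorem IsStandardForm.isDigraphOfCoeff_generatorDigraph {L : Mat N →ₗ[ℂ] Mat N} {H : Mat N}
    {Γ : CoeffMat N} (h : IsStandardForm L H Γ) : IsDigraphOfCoeff (generatorDigraph L) Γ where
  loopless i hi := hi.1 rfl
  weight i j hij := by
    have h0 := h.admissible.diag_nonneg hij
    have hre : ((Γ (i, j) (i, j)).re : ℂ) = Γ (i, j) (i, j) :=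
      Complex.ext rfl (Complex.le_def.1 h0).2
    simp only [generatorDigraph, gammaO, Matrix.submatrix_apply, h.apply_E hij]
    split_ifs with hpos
    · exact hre
    · rw [← hre, le_antisymm (not_lt.1 fun hp => hpos ⟨hij, hp⟩) (Complex.le_def.1 h0).1]

/-- Adjacency is recovered from the weights as positivity. -/
theorem WeightedDigraph.ext_of_w {V : Type*} {G G' : WeightedDigraph V} (h : G.w = G'.w) :
    G = G' := by
  have hadj : ∀ (K : WeightedDigraph V) i j, K.Adj i j ↔ 0 < K.w j i := fun K i j =>
    ⟨K.w_pos i j, fun hp => by_contra fun hn => hp.ne' (K.w_eq_zero i j hn)⟩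
  have hA : G.Adj = G'.Adj := by
    ext i j
    rw [hadj, hadj, h]
  obtain ⟨⟨A⟩, w, _, _⟩ := G
  obtain ⟨⟨A'⟩, w', _, _⟩ := G'
  subst h hA
  rfl

theorem IsDigraphOfCoeff.eq {G G' : WeightedDigraph (Fin N)} {Γ : CoeffMat N}
    (h : IsDigraphOfCoeff G Γ) (h' : IsDigraphOfCoeff G' Γ) : G = G' := by
  refine WeightedDigraph.ext_of_w (funext₂ fun i j => ?_)
  by_cases hij : i = j
  · subst hij
    rw [G.w_eq_zero i i (h.loopless i), G'.w_eq_zero i i (h'.loopless i)]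
  · exact Complex.ofReal_injective ((h.weight i j hij).trans (h'.weight i j hij).symm)

theorem IsGeneratorDigraph.compressionD_eq {L : Mat N →ₗ[ℂ] Mat N}
    {G : WeightedDigraph (Fin N)} (hG : IsGeneratorDigraph L G) :
    compressionD L = G.laplacian.map (fun x : ℝ => (x : ℂ)) := by
  obtain ⟨⟨H, Γ, hs⟩, hw⟩ := hG
  have hoff : ∀ i j : Fin N, i ≠ j → L (E j j) i i = G.w i j := fun i j hij =>
    (hs.apply_E hij).trans ((hw H Γ hs).weight i j hij).symm
  ext i j
  rw [compressionD_apply, Matrix.map_apply, WeightedDigraph.laplacian, Matrix.of_apply]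
  split_ifs with hij
  · subst hij
    -- Column `i` of the compression sums to `Tr L(E i i) = 0`, which fixes the diagonal entry.
    have htr : ∑ k, L (E i i) k k = 0 := by
      have := trace_gkslForm H Γ (E i i)
      rwa [← hs.form] at this
    rw [← Finset.add_sum_erase _ _ (Finset.mem_univ i)] at htr
    rw [eq_neg_of_add_eq_zero_left htr]
    push_cast
    exact congrArg _ (Finset.sum_congr rfl fun k hk => hoff k i (Finset.ne_of_mem_erase hk))
  · exact hoff i j hij

end QDS

theorem mainTheorem7 (N : ℕ) (L : QDS.Mat N →ₗ[ℂ] QDS.Mat N) (hL : QDS.IsQDSGenerator L) :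
    (∃! G : QDS.WeightedDigraph (Fin N), QDS.IsGeneratorDigraph L G) ∧
      ∀ G : QDS.WeightedDigraph (Fin N), QDS.IsGeneratorDigraph L G →
        QDS.compressionD L = G.laplacian.map (fun x : ℝ => (x : ℂ)) := by
  refine ⟨⟨QDS.generatorDigraph L, ⟨⟨0, _, hL.isStandardForm_choi⟩,
    fun _ _ h => h.isDigraphOfCoeff_generatorDigraph⟩, fun G hG => ?_⟩,
    fun G hG => hG.compressionD_eq⟩
  exact (hG.2 _ _ hL.isStandardForm_choi).eq
    hL.isStandardForm_choi.isDigraphOfCoeff_generatorDigraph
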